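/- Let $\mathbb{R}_1^2$ be the plane $\mathbb{R}^2$ with the metric $d_1((x_1,y_1),(x_2,y_2))=|x_1-x_2|+|y_1-y_2|$. For $A\subseteq\mathbb{R}_1^2$ let $L_x(A)=\bigcup_{y\in\mathbb{R}}[\{p\in A : p_2=y\}]$ and $L_y(A)=\bigcup_{x\in\mathbb{R}}[\{p\in A : p_1=x\}]$, where for a subset $X$ of a horizontal or vertical line $[X]$ denotes the smallest (possibly empty or infinite) segment containing $X$, i.e. its convex hull. For a metric space $(X,d)$, the tight span $T(X)$ is the set of pointwise minimal elements among the functions $f:X\to[0,\infty)$ with $f(x)+f(y)\ge d(x,y)$ for all $x,y\in X$, with the supremum metric $d_\infty(f,g)=\sup_{x\in X}|f(x)-g(x)|$. Let $A\subseteq\mathbb{R}_1^2$ be nonempty, compact and path connected. Then $L_x(L_y(A))=L_y(L_x(A))$; call this set $L(A)$. The set $L(A)$ is compact, and $L(A)$ (with the metric induced by $d_1$) is isometric to the tight span $T(A)$ of $A$ (with the metric induced by $d_1$). -/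

import Mathlib

/-- The Manhattan plane: pairs of real numbers with the metric
`|x₁ - x₂| + |y₁ - y₂|` (see `ManhattanPlane.dist_eq`). -/
abbrev ManhattanPlane : Type := WithLp 1 (ℝ × ℝ)

theorem ManhattanPlane.dist_eq (p q : ManhattanPlane) :
    dist p q = |p.fst - q.fst| + |p.snd - q.snd| := by
  rw [WithLp.prod_dist_eq_of_L1, Real.dist_eq, Real.dist_eq]

/-- Hatching in the `x`-direction: the union, over all horizontal lines, of the smallest segment
(possibly infinite or empty) containing the part of `A` on that line. The smallest segment
containing a subset of a line is its convex hull. -/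
def hatchX (A : Set ManhattanPlane) : Set ManhattanPlane :=
  ⋃ y : ℝ, convexHull ℝ {p | p ∈ A ∧ p.snd = y}

/-- Hatching in the `y`-direction. -/
def hatchY (A : Set ManhattanPlane) : Set ManhattanPlane :=
  ⋃ x : ℝ, convexHull ℝ {p | p ∈ A ∧ p.fst = x}

/-- The double hatching `L(A) = L_x (L_y A)`. -/
def doubleHatch (A : Set ManhattanPlane) : Set ManhattanPlane :=
  hatchX (hatchY A)

/-- Nonnegative functions `f` on `X` with `f x + f y ≥ d (x, y)` for all `x, y`. -/
def TightSpan.Admissible {X : Type*} [MetricSpace X] (f : X → ℝ) : Prop :=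
  (∀ x, 0 ≤ f x) ∧ ∀ x y, dist x y ≤ f x + f y

/-- The tight span of a metric space: the pointwise minimal admissible functions. -/
def TightSpan (X : Type*) [MetricSpace X] : Type _ :=
  {f : X → ℝ // Minimal TightSpan.Admissible f}

namespace TightSpan

theorem le_dist_add {X : Type*} [MetricSpace X] (f : TightSpan X) (x z : X) :
    f.1 x ≤ dist x z + f.1 z := by
  classical
  obtain ⟨h0, h1⟩ := f.2.prop
  by_contra hlt
  push Not at hlt
  have hzx := h0 z
  have key : Admissible (Function.update f.1 x (dist x z + f.1 z)) := by
    have hd : (0 : ℝ) ≤ dist x z := dist_nonneg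
    have aux : ∀ y, dist x y ≤ dist x z + f.1 z + f.1 y := fun y => by
      linarith [dist_triangle x z y, h1 z y]
    refine ⟨fun y => ?_, fun y w => ?_⟩
    · by_cases hy : y = x
      · subst hy; simp only [Function.update_self]; linarith
      · simp only [Function.update_of_ne hy]; exact h0 y
    · by_cases hy : y = x <;> by_cases hw : w = x
      · subst hy; subst hw; simp only [Function.update_self, dist_self]; linarith
      · subst hy; simp only [Function.update_self, Function.update_of_ne hw]; exact aux w
      · subst hw; simp only [Function.update_self, Function.update_of_ne hy]
        rw [dist_comm]; linarith [aux y]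
      · simp only [Function.update_of_ne hy, Function.update_of_ne hw]; exact h1 y w
  have hle : Function.update f.1 x (dist x z + f.1 z) ≤ f.1 := by
    intro y
    by_cases hy : y = x
    · subst hy; simp only [Function.update_self]; exact hlt.le
    · simp only [Function.update_of_ne hy]; exact le_rfl
  have h := f.2.le_of_le key hle x
  simp only [Function.update_self] at h
  linarith

theorem bddAbove {X : Type*} [MetricSpace X] (f g : TightSpan X) :
    BddAbove (Set.range fun x => |f.1 x - g.1 x|) := by
  rcases isEmpty_or_nonempty X with h | ⟨⟨z⟩⟩
  · simp [Set.range_eq_empty]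
  · refine ⟨f.1 z + g.1 z, ?_⟩
    rintro _ ⟨x, rfl⟩
    have hf := le_dist_add f x z
    have hg := le_dist_add g x z
    have hf' := f.2.prop.2 x z
    have hg' := g.2.prop.2 x z
    exact abs_le.2 ⟨by linarith, by linarith⟩

/-- The supremum metric on the tight span. -/
noncomputable instance instMetricSpace {X : Type*} [MetricSpace X] : MetricSpace (TightSpan X) where
  dist f g := ⨆ x, |f.1 x - g.1 x|
  dist_self f := by simp
  dist_comm f g := by simp only [abs_sub_comm]
  dist_triangle f g h := by
    refine Real.iSup_le (fun x => ?_) (add_nonneg (Real.iSup_nonneg fun _ => abs_nonneg _)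
      (Real.iSup_nonneg fun _ => abs_nonneg _))
    exact (abs_sub_le _ (g.1 x) _).trans
      (add_le_add (le_ciSup (bddAbove f g) x) (le_ciSup (bddAbove g h) x))
  eq_of_dist_eq_zero := by
    intro f g h
    refine Subtype.ext (funext fun x => ?_)
    have hx : |f.1 x - g.1 x| ≤ 0 := (le_ciSup (bddAbove f g) x).trans h.le
    exact sub_eq_zero.1 (abs_nonpos_iff.1 hx)

end TightSpan

/-!
The double hatching has a description that is symmetric in the two coordinates: a point `p` lies
in `L(A)` exactly when each of the four closed quadrants with apex `p` meets `A`
(`hatchX_hatchY_eq`, `hatchY_hatchX_eq`). Only one inclusion uses that `A` is path connected. If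
`A` meets both left quadrants at `p`, a path inside `A` joins the two meeting points; let it start
at the one further to the left, and stop it when it first reaches the abscissa of the other. The
intermediate value theorem, applied to this piece, produces a vertical line, weakly to the left of
`p`, on which `A` has points both weakly above and weakly below the height of `p`
(`IsPathConnected.exists_fiber_straddling`). Reflections give the other sides.

In this form compactness is clear, since each of the quadrant conditions is closed and together
they keep `p` in the bounding box of `A`. So is half of the isometry. The map sends `p ∈ L(A)` to
`d₁(p, ·)` on `A`. For `a ∈ A` the quadrant of `p` opposite to `a` contains some `b ∈ A`, and then
`d₁(a, b) = d₁(a, p) + d₁(p, b)`. Such equalities make `d₁(p, ·)` minimal, and applied to a second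
point of `L(A)` in place of `a` they show that the map preserves distances.

For surjectivity, let `f` belong to the tight span. The balls of radius `f a` around `a ∈ A` meet
pairwise, so they have a common point `p`: in the coordinates `x + y`, `x - y` they are squares with
axis-parallel sides (`ManhattanPlane.exists_forall_dist_le`). By minimality `f = d₁(p, ·)`, and
each `a ∈ A` has a partner `b ∈ A` with `p` between `a` and `b`. If `A` missed a closed quadrant
at `p`, no point of `A` could lie in the opposite open quadrant, so the two remaining quadrants
would separate `A`, contrary to connectedness (`mem_quadrantHull_of_forall_exists_opposite`).
-/

/-! ### Hatchings as betweenness conditions -/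

/-- The convex hull of a fibre of `g`, when `f` is a coordinate on each fibre. Stated for an
arbitrary pair of linear coordinates so that it applies to both directions of hatching. -/
theorem mem_convexHull_fiber_iff {E : Type*} [AddCommGroup E] [Module ℝ E] (f g : E →ₗ[ℝ] ℝ)
    (hfg : ∀ p q, f p = f q → g p = g q → p = q) (A : Set E) (c : ℝ) (p : E) :
    p ∈ convexHull ℝ {q | q ∈ A ∧ g q = c} ↔
      g p = c ∧ ∃ q ∈ A, ∃ r ∈ A, g q = c ∧ g r = c ∧ f q ≤ f p ∧ f p ≤ f r := by
  constructor
  · intro hp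
    let S : Set E := {p | g p = c ∧ ∃ q ∈ A, ∃ r ∈ A, g q = c ∧ g r = c ∧ f q ≤ f p ∧ f p ≤ f r}
    have hS : Convex ℝ S := by
      rintro u ⟨hu, q, hq, r, hr, hqc, hrc, hqu, hur⟩ v
        ⟨hv, q', hq', r', hr', hqc', hrc', hqv, hvr⟩ a b ha hb hab
      refine ⟨?_, ?_⟩
      · simp only [map_add, map_smul, smul_eq_mul, hu, hv]
        rw [← add_mul, hab, one_mul]
      · have hb' : b = 1 - a := by linarith
        subst hb'
        simp only [map_add, map_smul, smul_eq_mul]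
        rcases le_total (f u) (f v) with h | h
        · exact ⟨q, hq, r', hr', hqc, hrc', by nlinarith, by nlinarith⟩
        · exact ⟨q', hq', r, hr, hqc', hrc, by nlinarith, by nlinarith⟩
    refine convexHull_min ?_ hS hp
    rintro q ⟨hq, hqc⟩
    exact ⟨hqc, q, hq, q, hq, hqc, hqc, le_rfl, le_rfl⟩
  · rintro ⟨hpc, q, hq, r, hr, hqc, hrc, hqp, hpr⟩
    have hfp : f p ∈ segment ℝ (f q) (f r) := by
      rw [segment_eq_Icc (hqp.trans hpr)]
      exact ⟨hqp, hpr⟩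
    obtain ⟨a, b, ha, hb, hab, h⟩ := hfp
    have hp : p = a • q + b • r := by
      refine hfg _ _ ?_ ?_
      · simp only [map_add, map_smul, h]
      · simp only [map_add, map_smul, smul_eq_mul, hqc, hrc, hpc]
        rw [← add_mul, hab, one_mul]
    rw [hp]
    have hsub := subset_convexHull ℝ {q | q ∈ A ∧ g q = c}
    exact convex_convexHull ℝ _ (hsub ⟨hq, hqc⟩) (hsub ⟨hr, hrc⟩) ha hb hab

theorem ManhattanPlane.ext {p q : ManhattanPlane} (h₁ : p.fst = q.fst) (h₂ : p.snd = q.snd) :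
    p = q :=
  WithLp.ofLp_injective 1 (Prod.ext h₁ h₂)

theorem mem_hatchX_iff {A : Set ManhattanPlane} {p : ManhattanPlane} :
    p ∈ hatchX A ↔
      ∃ q ∈ A, ∃ r ∈ A, q.snd = p.snd ∧ r.snd = p.snd ∧ q.fst ≤ p.fst ∧ p.fst ≤ r.fst := by
  have key := mem_convexHull_fiber_iff (E := ManhattanPlane)
    (WithLp.fstₗ 1 ℝ ℝ ℝ) (WithLp.sndₗ 1 ℝ ℝ ℝ) (fun _ _ => ManhattanPlane.ext) A
  simp only [hatchX, Set.mem_iUnion]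
  constructor
  · rintro ⟨y, hy⟩
    obtain ⟨rfl, h⟩ := (key y p).1 hy
    exact h
  · exact fun h => ⟨p.snd, (key p.snd p).2 ⟨rfl, h⟩⟩

theorem mem_hatchY_iff {A : Set ManhattanPlane} {p : ManhattanPlane} :
    p ∈ hatchY A ↔
      ∃ q ∈ A, ∃ r ∈ A, q.fst = p.fst ∧ r.fst = p.fst ∧ q.snd ≤ p.snd ∧ p.snd ≤ r.snd := by
  have key := mem_convexHull_fiber_iff (E := ManhattanPlane)
    (WithLp.sndₗ 1 ℝ ℝ ℝ) (WithLp.fstₗ 1 ℝ ℝ ℝ)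
    (fun _ _ h₁ h₂ => ManhattanPlane.ext h₂ h₁) A
  simp only [hatchY, Set.mem_iUnion]
  constructor
  · rintro ⟨x, hx⟩
    obtain ⟨rfl, h⟩ := (key x p).1 hx
    exact h
  · exact fun h => ⟨p.fst, (key p.fst p).2 ⟨rfl, h⟩⟩

/-! ### The double hatching and quadrants -/

/-- The points `p` such that every closed quadrant with apex `p` meets `A`. Only the signs of `s`
and `t` matter, and they select the quadrant; a zero value gives a weaker condition. Letting `s`
and `t` range over all reals allows the quadrant opposite to `a` to be addressed by
`s = p.fst - a.fst`, `t = p.snd - a.snd` without a case distinction. -/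
def quadrantHull (A : Set ManhattanPlane) : Set ManhattanPlane :=
  {p | ∀ s t : ℝ, ∃ q ∈ A, 0 ≤ s * (q.fst - p.fst) ∧ 0 ≤ t * (q.snd - p.snd)}

/-- It suffices to test the four quadrants. -/
theorem mem_quadrantHull_iff {A : Set ManhattanPlane} {p : ManhattanPlane} :
    p ∈ quadrantHull A ↔
      (∃ q ∈ A, q.fst ≤ p.fst ∧ q.snd ≤ p.snd) ∧ (∃ q ∈ A, q.fst ≤ p.fst ∧ p.snd ≤ q.snd) ∧
      (∃ q ∈ A, p.fst ≤ q.fst ∧ q.snd ≤ p.snd) ∧ (∃ q ∈ A, p.fst ≤ q.fst ∧ p.snd ≤ q.snd) := by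
  constructor
  · intro h
    obtain ⟨q₁, hq₁, h₁, h₁'⟩ := h (-1) (-1)
    obtain ⟨q₂, hq₂, h₂, h₂'⟩ := h (-1) 1
    obtain ⟨q₃, hq₃, h₃, h₃'⟩ := h 1 (-1)
    obtain ⟨q₄, hq₄, h₄, h₄'⟩ := h 1 1
    exact ⟨⟨q₁, hq₁, by linarith, by linarith⟩, ⟨q₂, hq₂, by linarith, by linarith⟩,
      ⟨q₃, hq₃, by linarith, by linarith⟩, ⟨q₄, hq₄, by linarith, by linarith⟩⟩
  · rintro ⟨⟨q₁, hq₁, h₁, h₁'⟩, ⟨q₂, hq₂, h₂, h₂'⟩, ⟨q₃, hq₃, h₃, h₃'⟩, ⟨q₄, hq₄, h₄, h₄'⟩⟩ s t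
    rcases le_total 0 s with hs | hs <;> rcases le_total 0 t with ht | ht
    · exact ⟨q₄, hq₄, mul_nonneg hs (by linarith), mul_nonneg ht (by linarith)⟩
    · exact ⟨q₃, hq₃, mul_nonneg hs (by linarith), mul_nonneg_of_nonpos_of_nonpos ht (by linarith)⟩
    · exact ⟨q₂, hq₂, mul_nonneg_of_nonpos_of_nonpos hs (by linarith), mul_nonneg ht (by linarith)⟩
    · exact ⟨q₁, hq₁, mul_nonneg_of_nonpos_of_nonpos hs (by linarith),
        mul_nonneg_of_nonpos_of_nonpos ht (by linarith)⟩

/-- If a path connected set has points in both quadrants `{f ≤ c, d ≤ g}` and `{f ≤ c, g ≤ d}`,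
then some fibre `{f = x}` with `x ≤ c` contains points of it on both sides of `{g = d}`. -/
theorem IsPathConnected.exists_fiber_straddling {X : Type*} [TopologicalSpace X] {A : Set X}
    (hA : IsPathConnected A) {f g : X → ℝ} (hf : Continuous f) (hg : Continuous g) {c d : ℝ}
    {u v : X} (hu : u ∈ A) (hv : v ∈ A) (huc : f u ≤ c) (hvc : f v ≤ c) (hud : d ≤ g u)
    (hvd : g v ≤ d) :
    ∃ x ≤ c, (∃ q ∈ A, f q = x ∧ g q ≤ d) ∧ ∃ r ∈ A, f r = x ∧ d ≤ g r := by
  -- Reversing the sign of `g` exchanges the roles of `u` and `v`.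
  wlog huv : f u ≤ f v generalizing g d u v
  · obtain ⟨x, hx, ⟨q, hq, hqx, hqd⟩, r, hr, hrx, hrd⟩ := this (g := fun p => -g p) hg.neg hv hu
      hvc huc (neg_le_neg hvd) (neg_le_neg hud) (le_of_not_ge huv)
    exact ⟨x, hx, ⟨r, hr, hrx, neg_le_neg_iff.1 hrd⟩, q, hq, hqx, neg_le_neg_iff.1 hqd⟩
  obtain ⟨γ, hγ⟩ := hA.joinedIn u hu v hv
  have hmem : ∀ t : ℝ, γ.extend t ∈ A := fun t => hγ _
  have hfγ : Continuous fun t => f (γ.extend t) := hf.comp γ.continuous_extend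
  have hgγ : Continuous fun t => g (γ.extend t) := hg.comp γ.continuous_extend
  -- `T` is the first time at which the path reaches the fibre of `f` through `v`.
  obtain ⟨T, ⟨hT, hfT⟩, hTmin⟩ :
      ∃ T, IsLeast (Set.Icc (0 : ℝ) 1 ∩ {t | f (γ.extend t) = f v}) T :=
    (isCompact_Icc.inter_right (isClosed_eq hfγ continuous_const)).exists_isLeast
      ⟨1, by simp, by simp⟩
  rcases le_total d (g (γ.extend T)) with hdT | hdT
  · exact ⟨f v, hvc, ⟨v, hv, rfl, hvd⟩, _, hmem T, hfT, hdT⟩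
  · -- Up to time `T` the path stays in `{f ≤ c}`, and it crosses `{g = d}`.
    obtain ⟨t, ht, htd⟩ := intermediate_value_Icc' hT.1 hgγ.continuousOn
      (show d ∈ Set.Icc _ _ from ⟨hdT, by simpa using hud⟩)
    refine ⟨f (γ.extend t), ?_, ⟨_, hmem t, rfl, htd.le⟩, _, hmem t, rfl, htd.ge⟩
    by_contra! hct
    -- A time with `f > c ≥ f v` is preceded by an earlier visit to the fibre through `v`.
    obtain ⟨r, hr, hrv⟩ := intermediate_value_Icc ht.1 hfγ.continuousOn
      (show f v ∈ Set.Icc _ _ from ⟨by simpa using huv, hvc.trans hct.le⟩)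
    have hTr : T ≤ r := hTmin ⟨⟨hr.1, hr.2.trans (ht.2.trans hT.2)⟩, hrv⟩
    have hTt : t = T := le_antisymm ht.2 (hTr.trans hr.2)
    subst hTt
    exact absurd hct (not_lt.2 (le_of_eq_of_le hfT hvc))

theorem ManhattanPlane.continuous_fst : Continuous fun p : ManhattanPlane => p.fst :=
  (WithLp.fstL 1 ℝ ℝ ℝ).continuous

theorem ManhattanPlane.continuous_snd : Continuous fun p : ManhattanPlane => p.snd :=
  (WithLp.sndL 1 ℝ ℝ ℝ).continuous

open ManhattanPlane in
theorem hatchX_hatchY_eq {A : Set ManhattanPlane} (hA : IsPathConnected A) :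
    hatchX (hatchY A) = quadrantHull A := by
  ext p
  simp only [mem_hatchX_iff, mem_hatchY_iff, mem_quadrantHull_iff]
  constructor
  · rintro ⟨l, ⟨q₁, hq₁, q₂, hq₂, h₁, h₂, h₁', h₂'⟩, r, ⟨q₃, hq₃, q₄, hq₄, h₃, h₄, h₃', h₄'⟩,
      hl, hr, hlp, hpr⟩
    exact ⟨⟨q₁, hq₁, by linarith, by linarith⟩, ⟨q₂, hq₂, by linarith, by linarith⟩,
      ⟨q₃, hq₃, by linarith, by linarith⟩, ⟨q₄, hq₄, by linarith, by linarith⟩⟩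
  · rintro ⟨⟨q₁, hq₁, h₁, h₁'⟩, ⟨q₂, hq₂, h₂, h₂'⟩, ⟨q₃, hq₃, h₃, h₃'⟩, ⟨q₄, hq₄, h₄, h₄'⟩⟩
    obtain ⟨x, hx, ⟨a, ha, hax, had⟩, b, hb, hbx, hbd⟩ :=
      hA.exists_fiber_straddling continuous_fst continuous_snd hq₂ hq₁ h₂ h₁ h₂' h₁'
    -- The right side is the left side for the reflected abscissa `-fst`.
    obtain ⟨x', hx', ⟨a', ha', hax', had'⟩, b', hb', hbx', hbd'⟩ :=
      hA.exists_fiber_straddling continuous_fst.neg continuous_snd hq₄ hq₃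
        (neg_le_neg h₄) (neg_le_neg h₃) h₄' h₃'
    exact ⟨WithLp.toLp 1 (x, p.snd), ⟨a, ha, b, hb, hax, hbx, had, hbd⟩,
      WithLp.toLp 1 (-x', p.snd), ⟨a', ha', b', hb', by simp [← hax'], by simp [← hbx'], had', hbd'⟩,
      rfl, rfl, hx, le_neg_of_le_neg hx'⟩

open ManhattanPlane in
theorem hatchY_hatchX_eq {A : Set ManhattanPlane} (hA : IsPathConnected A) :
    hatchY (hatchX A) = quadrantHull A := by
  ext p
  simp only [mem_hatchX_iff, mem_hatchY_iff, mem_quadrantHull_iff]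
  constructor
  · rintro ⟨l, ⟨q₁, hq₁, q₂, hq₂, h₁, h₂, h₁', h₂'⟩, r, ⟨q₃, hq₃, q₄, hq₄, h₃, h₄, h₃', h₄'⟩,
      hl, hr, hlp, hpr⟩
    exact ⟨⟨q₁, hq₁, by linarith, by linarith⟩, ⟨q₃, hq₃, by linarith, by linarith⟩,
      ⟨q₂, hq₂, by linarith, by linarith⟩, ⟨q₄, hq₄, by linarith, by linarith⟩⟩
  · rintro ⟨⟨q₁, hq₁, h₁, h₁'⟩, ⟨q₂, hq₂, h₂, h₂'⟩, ⟨q₃, hq₃, h₃, h₃'⟩, ⟨q₄, hq₄, h₄, h₄'⟩⟩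
    obtain ⟨y, hy, ⟨a, ha, hay, had⟩, b, hb, hby, hbd⟩ :=
      hA.exists_fiber_straddling continuous_snd continuous_fst hq₃ hq₁ h₃' h₁' h₃ h₁
    obtain ⟨y', hy', ⟨a', ha', hay', had'⟩, b', hb', hby', hbd'⟩ :=
      hA.exists_fiber_straddling continuous_snd.neg continuous_fst hq₄ hq₂
        (neg_le_neg h₄') (neg_le_neg h₂') h₄ h₂
    exact ⟨WithLp.toLp 1 (p.fst, y), ⟨a, ha, b, hb, hay, hby, had, hbd⟩,
      WithLp.toLp 1 (p.fst, -y'), ⟨a', ha', b', hb', by simp [← hay'], by simp [← hby'], had', hbd'⟩,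
      rfl, rfl, hy, le_neg_of_le_neg hy'⟩

/-! ### Betweenness and compactness -/

/-- A sum of two real distances collapses exactly when the middle point lies between the others. -/
theorem abs_sub_add_abs_sub_eq_iff {a p b : ℝ} :
    |a - p| + |p - b| = |a - b| ↔ 0 ≤ (p - a) * (b - p) := by
  have h : a - b = (a - p) + (p - b) := by ring
  rw [h, eq_comm, abs_add_eq_add_abs_iff, mul_nonneg_iff]
  constructor
  · rintro (⟨h₁, h₂⟩ | ⟨h₁, h₂⟩)
    · exact Or.inr ⟨by linarith, by linarith⟩
    · exact Or.inl ⟨by linarith, by linarith⟩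
  · rintro (⟨h₁, h₂⟩ | ⟨h₁, h₂⟩)
    · exact Or.inr ⟨by linarith, by linarith⟩
    · exact Or.inl ⟨by linarith, by linarith⟩

theorem ManhattanPlane.dist_add_dist_eq_iff {a p b : ManhattanPlane} :
    dist a p + dist p b = dist a b ↔
      0 ≤ (p.fst - a.fst) * (b.fst - p.fst) ∧ 0 ≤ (p.snd - a.snd) * (b.snd - p.snd) := by
  rw [← abs_sub_add_abs_sub_eq_iff, ← abs_sub_add_abs_sub_eq_iff, dist_eq, dist_eq, dist_eq]
  have h₁ := abs_sub_le a.fst p.fst b.fst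
  have h₂ := abs_sub_le a.snd p.snd b.snd
  constructor
  · exact fun h => ⟨by linarith, by linarith⟩
  · rintro ⟨h, h'⟩
    linarith

/-- Every geodesic from any point `a` to a point `p` of the quadrant hull of `A` can be prolonged
to a point of `A`. -/
theorem exists_dist_add_dist_eq_of_mem_quadrantHull {A : Set ManhattanPlane} {p : ManhattanPlane}
    (hp : p ∈ quadrantHull A) (a : ManhattanPlane) : ∃ b ∈ A, dist a p + dist p b = dist a b := by
  obtain ⟨b, hb, h⟩ := hp (p.fst - a.fst) (p.snd - a.snd)
  exact ⟨b, hb, ManhattanPlane.dist_add_dist_eq_iff.2 h⟩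

theorem isClosed_quadrantHull {A : Set ManhattanPlane} (hA : IsCompact A) :
    IsClosed (quadrantHull A) := by
  have := isCompact_iff_compactSpace.1 hA
  simp only [quadrantHull, Set.ofPred_forall]
  refine isClosed_iInter fun s => isClosed_iInter fun t => ?_
  have hC : IsClosed {z : ManhattanPlane × A |
      0 ≤ s * (z.2.1.fst - z.1.fst) ∧ 0 ≤ t * (z.2.1.snd - z.1.snd)} := by
    have h₁ := ManhattanPlane.continuous_fst
    have h₂ := ManhattanPlane.continuous_snd
    have hF : Continuous fun z : ManhattanPlane × A => s * (z.2.1.fst - z.1.fst) :=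
      continuous_const.mul
        ((h₁.comp (continuous_subtype_val.comp continuous_snd)).sub (h₁.comp continuous_fst))
    have hG : Continuous fun z : ManhattanPlane × A => t * (z.2.1.snd - z.1.snd) :=
      continuous_const.mul
        ((h₂.comp (continuous_subtype_val.comp continuous_snd)).sub (h₂.comp continuous_fst))
    exact (isClosed_le continuous_const hF).inter (isClosed_le continuous_const hG)
  convert isClosedMap_fst_of_compactSpace _ hC using 1
  ext p
  simp [and_left_comm]

theorem isCompact_quadrantHull {A : Set ManhattanPlane} (hA : IsCompact A) (hne : A.Nonempty) :
    IsCompact (quadrantHull A) := by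
  have : ProperSpace ManhattanPlane := FiniteDimensional.proper_real _
  obtain ⟨a, ha⟩ := hne
  refine (isCompact_closedBall a (Metric.diam A)).of_isClosed_subset (isClosed_quadrantHull hA) ?_
  intro p hp
  obtain ⟨b, hb, h⟩ := exists_dist_add_dist_eq_of_mem_quadrantHull hp a
  have hab := Metric.dist_le_diam_of_mem hA.isBounded ha hb
  rw [Metric.mem_closedBall, dist_comm]
  linarith [dist_nonneg (x := p) (y := b)]

/-! ### The map into the tight span -/

theorem admissible_dist (A : Set ManhattanPlane) (p : ManhattanPlane) :
    TightSpan.Admissible fun a : A => dist p a := by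
  refine ⟨fun _ => dist_nonneg, fun a b => ?_⟩
  rw [Subtype.dist_eq]
  exact dist_triangle_left (a : ManhattanPlane) b p

open TightSpan in
theorem minimal_admissible_dist {A : Set ManhattanPlane} {p : ManhattanPlane}
    (hp : p ∈ quadrantHull A) : Minimal Admissible fun a : A => dist p a := by
  refine ⟨admissible_dist A p, fun g hg hgp a => ?_⟩
  obtain ⟨b, hb, h⟩ := exists_dist_add_dist_eq_of_mem_quadrantHull hp a
  have hab : dist (a : ManhattanPlane) b ≤ g a + g ⟨b, hb⟩ := hg.2 a ⟨b, hb⟩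
  have hgb : g ⟨b, hb⟩ ≤ dist p b := hgp ⟨b, hb⟩
  show dist p a ≤ g a
  rw [dist_comm p]
  linarith

/-- The Kuratowski embedding, restricted to the quadrant hull of `A`: a point is sent to its
distances from the points of `A`. -/
noncomputable def quadrantHullToTightSpan (A : Set ManhattanPlane) (p : quadrantHull A) :
    TightSpan A :=
  ⟨fun a => dist (p : ManhattanPlane) a, minimal_admissible_dist p.2⟩

theorem isometry_quadrantHullToTightSpan {A : Set ManhattanPlane} :
    Isometry (quadrantHullToTightSpan A) := by
  refine Isometry.of_dist_eq fun p q => le_antisymm ?_ ?_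
  · exact Real.iSup_le (fun a => abs_dist_sub_le _ _ _) dist_nonneg
  · obtain ⟨b, hb, h⟩ := exists_dist_add_dist_eq_of_mem_quadrantHull q.2 (p : ManhattanPlane)
    refine le_trans ?_ (le_ciSup (TightSpan.bddAbove (quadrantHullToTightSpan A p)
      (quadrantHullToTightSpan A q)) ⟨b, hb⟩)
    refine le_trans ?_ (le_abs_self _)
    show dist (p : ManhattanPlane) q ≤ dist (p : ManhattanPlane) b - dist (q : ManhattanPlane) b
    linarith

/-! ### Surjectivity -/

/-- Hyperconvexity of the plane: pairwise intersecting balls have a common point. -/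
theorem ManhattanPlane.exists_forall_dist_le {ι : Type*} [Nonempty ι] (c : ι → ManhattanPlane)
    (r : ι → ℝ) (h : ∀ i j, dist (c i) (c j) ≤ r i + r j) : ∃ p, ∀ i, dist p (c i) ≤ r i := by
  -- A family of pairwise intersecting intervals has a common point.
  have helly : ∀ u : ι → ℝ, (∀ i j, u i - u j ≤ r i + r j) →
      ∃ x, ∀ i, u i - r i ≤ x ∧ x ≤ u i + r i := by
    intro u hu
    have hle : ∀ i j, u i - r i ≤ u j + r j := fun i j => by linarith [hu i j]
    refine ⟨⨆ i, (u i - r i), fun i => ⟨?_, ciSup_le fun j => hle j i⟩⟩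
    exact le_ciSup (f := fun i => u i - r i) ⟨u i + r i, by rintro _ ⟨j, rfl⟩; exact hle j i⟩ i
  simp only [dist_eq] at h ⊢
  obtain ⟨x, hx⟩ := helly (fun i => (c i).fst + (c i).snd) fun i j => by
    linarith [h i j, le_abs_self ((c i).fst - (c j).fst), le_abs_self ((c i).snd - (c j).snd)]
  obtain ⟨y, hy⟩ := helly (fun i => (c i).fst - (c i).snd) fun i j => by
    linarith [h i j, le_abs_self ((c i).fst - (c j).fst), neg_abs_le ((c i).snd - (c j).snd)]
  -- `x` and `y` are the values of `fst + snd` and `fst - snd` at the common point.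
  refine ⟨WithLp.toLp 1 ((x + y) / 2, (x - y) / 2), fun i => ?_⟩
  obtain ⟨hx₁, hx₂⟩ := hx i
  obtain ⟨hy₁, hy₂⟩ := hy i
  simp only [WithLp.toLp_fst, WithLp.toLp_snd]
  rcases abs_cases ((x + y) / 2 - (c i).fst) with ⟨e, -⟩ | ⟨e, -⟩ <;>
    rcases abs_cases ((x - y) / 2 - (c i).snd) with ⟨e', -⟩ | ⟨e', -⟩ <;>
    rw [e, e'] <;> linarith

/-- The value of a minimal admissible function at a point is the least one allowed by its other
values. -/
theorem TightSpan.le_of_forall_dist_le {X : Type*} [MetricSpace X] (f : TightSpan X) (x : X)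
    {c : ℝ} (hc : 0 ≤ c) (h : ∀ y, dist x y ≤ c + f.1 y) : f.1 x ≤ c := by
  classical
  by_contra! hlt
  obtain ⟨h0, h1⟩ := f.2.prop
  have key : Admissible (Function.update f.1 x c) := by
    refine ⟨fun y => ?_, fun y w => ?_⟩
    · by_cases hy : y = x
      · subst hy; simpa using hc
      · simpa [hy] using h0 y
    · by_cases hy : y = x <;> by_cases hw : w = x
      · subst hy; subst hw; simpa using hc
      · subst hy; simpa [hw] using h w
      · subst hw; simpa [hy, dist_comm, add_comm] using h y
      · simpa [hy, hw] using h1 y w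
  have hle : Function.update f.1 x c ≤ f.1 := by
    intro y
    by_cases hy : y = x
    · subst hy; simpa using hlt.le
    · simp [hy]
  have := f.2.le_of_le key hle x
  simp only [Function.update_self] at this
  linarith

/-- On a compact space the defining inequality of a minimal admissible function is attained. -/
theorem TightSpan.exists_add_eq_dist {X : Type*} [MetricSpace X] [CompactSpace X]
    (f : TightSpan X) (x : X) : ∃ y, f.1 x + f.1 y = dist x y := by
  obtain ⟨h0, h1⟩ := f.2.prop
  have hf : Continuous f.1 := (LipschitzWith.of_le_add fun y z => by
    linarith [f.le_dist_add y z]).continuous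
  have : Nonempty X := ⟨x⟩
  obtain ⟨y, -, hy⟩ := isCompact_univ.exists_isMaxOn Set.univ_nonempty
    ((continuous_const.dist continuous_id).sub hf).continuousOn (f := fun y => dist x y - f.1 y)
  have hmax : ∀ z, dist x z - f.1 z ≤ dist x y - f.1 y := fun z => hy (Set.mem_univ z)
  rcases (h0 x).eq_or_lt with hx | hx
  · exact ⟨x, by rw [← hx, dist_self, add_zero]⟩
  · refine ⟨y, le_antisymm ?_ (h1 x y)⟩
    have hle := f.le_of_forall_dist_le x (le_max_right (dist x y - f.1 y) 0) fun z => by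
      linarith [hmax z, le_max_left (dist x y - f.1 y) 0]
    rcases le_max_iff.1 hle with h | h
    · linarith
    · exact absurd h (not_le.2 hx)

/-- If `p` lies between each point of the connected set `A` and some point of `A`, then `A`
meets every closed quadrant at `p`. -/
theorem mem_quadrantHull_of_forall_exists_opposite {A : Set ManhattanPlane}
    (hA : IsConnected A) {p : ManhattanPlane}
    (h : ∀ a ∈ A, ∃ b ∈ A, dist a p + dist p b = dist a b) : p ∈ quadrantHull A := by
  by_contra hp
  simp only [quadrantHull, Set.mem_ofPred_eq, not_forall, not_exists, not_and, not_le] at hp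
  obtain ⟨s, t, hst⟩ := hp
  set F : ManhattanPlane → ℝ := fun q => s * (q.fst - p.fst) with hF
  set G : ManhattanPlane → ℝ := fun q => t * (q.snd - p.snd) with hG
  have hcover : ∀ q ∈ A, F q < 0 ∨ G q < 0 := fun q hq => by
    by_contra! hq'
    exact absurd hq'.2 (not_le.2 (hst q hq hq'.1))
  -- `F` and `G` do not take the same strict sign at a point and its opposite.
  have hopp : ∀ a ∈ A, ∃ b ∈ A, F a * F b ≤ 0 ∧ G a * G b ≤ 0 := fun a ha => by
    obtain ⟨b, hb, hab⟩ := h a ha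
    obtain ⟨h₁, h₂⟩ := ManhattanPlane.dist_add_dist_eq_iff.1 hab
    refine ⟨b, hb, ?_, ?_⟩
    · have : F a * F b = -(s ^ 2 * ((p.fst - a.fst) * (b.fst - p.fst))) := by simp only [hF]; ring
      rw [this]
      exact neg_nonpos.2 (by positivity)
    · have : G a * G b = -(t ^ 2 * ((p.snd - a.snd) * (b.snd - p.snd))) := by simp only [hG]; ring
      rw [this]
      exact neg_nonpos.2 (by positivity)
  have hdisj : ∀ a ∈ A, ¬(F a < 0 ∧ G a < 0) := by
    rintro a ha ⟨haF, haG⟩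
    obtain ⟨b, hb, hbF, hbG⟩ := hopp a ha
    rcases hcover b hb with h' | h'
    · exact absurd hbF (not_le.2 (mul_pos_of_neg_of_neg haF h'))
    · exact absurd hbG (not_le.2 (mul_pos_of_neg_of_neg haG h'))
  -- The opposite of a point in one of the sets `{F < 0}`, `{G < 0}` lies in the other one.
  have hmeet : (∃ a ∈ A, F a < 0) ∧ ∃ a ∈ A, G a < 0 := by
    obtain ⟨a, ha⟩ := hA.nonempty
    obtain ⟨b, hb, hbF, hbG⟩ := hopp a ha
    rcases hcover a ha with h' | h'
    · exact ⟨⟨a, ha, h'⟩, b, hb, (hcover b hb).resolve_left fun h'' =>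
        absurd hbF (not_le.2 (mul_pos_of_neg_of_neg h' h''))⟩
    · exact ⟨⟨b, hb, (hcover b hb).resolve_right fun h'' =>
        absurd hbG (not_le.2 (mul_pos_of_neg_of_neg h' h''))⟩, a, ha, h'⟩
  have hFc : Continuous F :=
    continuous_const.mul (ManhattanPlane.continuous_fst.sub continuous_const)
  have hGc : Continuous G :=
    continuous_const.mul (ManhattanPlane.continuous_snd.sub continuous_const)
  obtain ⟨q, hq, hqFG⟩ := hA.isPreconnected {q | F q < 0} {q | G q < 0}
    (isOpen_lt hFc continuous_const) (isOpen_lt hGc continuous_const) hcover hmeet.1 hmeet.2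
  exact hdisj q hq hqFG

theorem surjective_quadrantHullToTightSpan {A : Set ManhattanPlane} (hA : IsCompact A)
    (hc : IsConnected A) : Function.Surjective (quadrantHullToTightSpan A) := by
  intro f
  have := isCompact_iff_compactSpace.1 hA
  have : Nonempty A := hc.nonempty.to_subtype
  obtain ⟨p, hp⟩ := ManhattanPlane.exists_forall_dist_le (fun a : A => (a : ManhattanPlane)) f.1
    f.2.prop.2
  have hfp : ∀ a : A, f.1 a = dist p a := fun a =>
    le_antisymm (f.2.le_of_le (admissible_dist A p) hp a) (hp a)
  refine ⟨⟨p, mem_quadrantHull_of_forall_exists_opposite hc fun a ha => ?_⟩,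
    Subtype.ext (funext fun a => (hfp a).symm)⟩
  obtain ⟨b, hb⟩ := f.exists_add_eq_dist ⟨a, ha⟩
  rw [hfp, hfp] at hb
  exact ⟨b, b.2, by rw [dist_comm a p]; exact hb⟩

theorem mainTheorem3 (A : Set ManhattanPlane) (hA : IsCompact A) (hA' : IsPathConnected A) :
    hatchX (hatchY A) = hatchY (hatchX A) ∧
      IsCompact (doubleHatch A) ∧
      Nonempty (doubleHatch A ≃ᵢ TightSpan A) := by
  have hL : doubleHatch A = quadrantHull A := hatchX_hatchY_eq hA'
  refine ⟨(hatchX_hatchY_eq hA').trans (hatchY_hatchX_eq hA').symm, ?_, ?_⟩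
  · rw [hL]
    exact isCompact_quadrantHull hA hA'.nonempty
  · rw [hL]
    exact ⟨⟨Equiv.ofBijective _ ⟨isometry_quadrantHullToTightSpan.injective,
      surjective_quadrantHullToTightSpan hA hA'.isConnected⟩, isometry_quadrantHullToTightSpan⟩⟩
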